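/- A job $j$ has a release time $r_j$, a deadline $d_j$ and a size $p_j$ with $0<p_j\le d_j-r_j$; its lifespan is $I(j)=[r_j,d_j)$ and its laxity is $\ell_j=d_j-r_j-p_j$. For $\alpha\in(0,1)$ the job is $\alpha$-tight if $p_j\ge\alpha(d_j-r_j)$. For a finite set $J$ of jobs let $m^*$ be the minimum number of identical machines on which $J$ has a feasible preemptive schedule with migration (each machine processes at most one job at a time, each job is processed by at most one machine at a time and only during its lifespan, and each job $j$ is processed for $p_j$ time units in total). Let $G\subseteq J$ be a set of $\alpha$-tight jobs and let $T\subseteq\mathbb R$ be a non-empty finite union of intervals. For $\mu\in\mathbb N$ and $\beta\in(0,1)$ the pair $(G,T)$ is called $(\mu,\beta)$-critical if every $t\in T$ lies in the lifespans of at least $\mu$ distinct jobs of $G$, and $|T\cap I(j)|\ge\beta\,\ell_j$ for every $j\in G$, where $|\cdot|$ denotes Lebesgue measure. Theorem. There is an absolute constant $c>0$ such that for every finite set $J$ of jobs, all $\alpha,\beta\in(0,1)$ and every $\mu\in\mathbb N$: if all jobs of $J$ are $\alpha$-tight and there is a $(\mu,\beta)$-critical pair $(G,T)$ with $G\subseteq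 J$, then $$m^*\;\ge\; c\cdot\frac{\mu}{\log_{1/(1-\alpha)}(1/\hat\beta)},\qquad \hat\beta=\min\{\beta,\ \tfrac12,\ 1-\alpha\}.$$ In particular, $m^*\ge c\,\mu/\log_{1/(1-\alpha)}(1/\beta)$ whenever $\beta\le\min\{\tfrac12,1-\alpha\}$. -/

import Mathlib

open MeasureTheory

/-- A job: it is released at time `release`, has to be completed by time `deadline`, and needs
`size > 0` units of processing, which fit between release and deadline. -/
structure Job where
  release : ℝ
  deadline : ℝ
  size : ℝ
  size_pos : 0 < size
  size_le : size ≤ deadline - release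

namespace Job

/-- The lifespan `I(j) = [r_j, d_j)`. -/
def lifespan (j : Job) : Set ℝ := Set.Ico j.release j.deadline

/-- The laxity `ℓ_j = d_j - r_j - p_j`. -/
def laxity (j : Job) : ℝ := j.deadline - j.release - j.size

/-- A job is `α`-tight if its size is at least an `α` fraction of the length of its lifespan. -/
def IsTight (α : ℝ) (j : Job) : Prop := α * (j.deadline - j.release) ≤ j.size

end Job

/-- A feasible preemptive schedule (with migration) of the jobs `J` on `m` identical machines.
`σ i t = some j` means that machine `i` processes job `j` at time `t`, and `σ i t = none` that
machine `i` is idle at time `t`; so a machine processes at most one job at a time. -/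
structure IsFeasibleSchedule {ι : Type*} (J : ι → Job) {m : ℕ} (σ : Fin m → ℝ → Option ι) :
    Prop where
  /-- The set of times at which a given machine processes a given job is measurable. -/
  measurableSet : ∀ i j, MeasurableSet {t | σ i t = some j}
  /-- A job is processed only during its lifespan. -/
  mem_lifespan : ∀ i t j, σ i t = some j → t ∈ (J j).lifespan
  /-- At any time a job is processed by at most one machine. -/
  not_parallel : ∀ i i' t j, σ i t = some j → σ i' t = some j → i = i'
  /-- Every job receives all the processing that it needs. -/
  complete : ∀ j, ∑ i, volume.real {t | σ i t = some j} = (J j).size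

/-- The jobs `J` can be feasibly scheduled on `m` machines. -/
def Schedulable {ι : Type*} (J : ι → Job) (m : ℕ) : Prop :=
  ∃ σ : Fin m → ℝ → Option ι, IsFeasibleSchedule J σ

/-- `m*`, the minimum number of machines on which the jobs `J` can be feasibly scheduled. For
finitely many jobs the minimum exists, see `schedulable_minMachines`. -/
noncomputable def minMachines {ι : Type*} (J : ι → Job) : ℕ := sInf {m | Schedulable J m}

/-- One machine for each job is always enough. -/
theorem schedulable_card {ι : Type*} [Fintype ι] (J : ι → Job) :
    Schedulable J (Fintype.card ι) := by
  classical
  let e := Fintype.equivFin ι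
  let S : ι → Set ℝ := fun j => Set.Ico (J j).release ((J j).release + (J j).size)
  have key : ∀ (i : Fin (Fintype.card ι)) (t : ℝ) (j : ι),
      (if t ∈ S (e.symm i) then some (e.symm i) else none) = some j ↔
        e.symm i = j ∧ t ∈ S j := by
    intro i t j
    constructor
    · intro h
      split_ifs at h with h1
      obtain rfl := Option.some.inj h
      exact ⟨rfl, h1⟩
    · rintro ⟨rfl, h⟩
      rw [if_pos h]
  have hset : ∀ (i : Fin (Fintype.card ι)) (j : ι),
      {t | (if t ∈ S (e.symm i) then some (e.symm i) else none) = some j} =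
        if e.symm i = j then S j else ∅ := by
    intro i j
    ext t
    simp only [Set.mem_ofPred_eq, key]
    split_ifs with h <;> simp [h]
  refine ⟨fun i t => if t ∈ S (e.symm i) then some (e.symm i) else none, ?_, ?_, ?_, ?_⟩
  · intro i j
    rw [hset]
    split_ifs
    · exact measurableSet_Ico
    · exact MeasurableSet.empty
  · intro i t j h
    have h1 := ((key i t j).1 h).2
    have h2 := (J j).size_le
    exact ⟨h1.1, lt_of_lt_of_le h1.2 (by linarith)⟩
  · intro i i' t j h h'
    exact e.symm.injective (((key i t j).1 h).1.trans ((key i' t j).1 h').1.symm)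
  · intro j
    simp only [hset]
    rw [Finset.sum_eq_single (e j)]
    · have := (J j).size_pos
      simp [S, this.le]
    · intro i _ hi
      have : e.symm i ≠ j := fun h => hi (by rw [← h, Equiv.apply_symm_apply])
      simp [this]
    · simp

theorem schedulable_minMachines {ι : Type*} [Fintype ι] (J : ι → Job) :
    Schedulable J (minMachines J) :=
  Nat.sInf_mem (s := {m | Schedulable J m}) ⟨_, schedulable_card J⟩

/-- `T` is a finite union of intervals (of any kind). -/
def IsFiniteUnionOfIntervals (T : Set ℝ) : Prop :=
  ∃ F : Set (Set ℝ), F.Finite ∧ (∀ I ∈ F, I.OrdConnected) ∧ T = ⋃₀ F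

/-- `(G, T)` is a `(μ, β)`-critical pair: `G` is a set of `α`-tight jobs and `T` is a non-empty
finite union of intervals, such that each time in `T` lies in the lifespans of at least `μ`
distinct jobs of `G`, and `|T ∩ I(j)| ≥ β ℓ_j` for all jobs `j` of `G`. -/
structure IsCriticalPair {ι : Type*} (J : ι → Job) (α : ℝ) (μ : ℕ) (β : ℝ) (G : Set ι)
    (T : Set ℝ) : Prop where
  tight : ∀ j ∈ G, (J j).IsTight α
  nonempty : T.Nonempty
  intervals : IsFiniteUnionOfIntervals T
  covered : ∀ t ∈ T, μ ≤ {j | j ∈ G ∧ t ∈ (J j).lifespan}.ncard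
  laxity_le : ∀ j ∈ G, β * (J j).laxity ≤ volume.real (T ∩ (J j).lifespan)

/-!
Fix a feasible schedule on `m` machines. During a measurable set `S` of times, a job `j` has to be
processed for at least `|S ∩ I(j)| - ℓ_j` time units, so the positive parts of these numbers sum to
at most `m |S|` (`Schedulable.sum_load_le`). This bound is applied to a whole family of sets.

For `0 < s ≤ 1` the set `T` of the critical pair is expanded to a set `S` in which it has density
about `s`: `s |S| ≤ 2 |T|`, and `s |S ∩ I| ≥ min (s |I|) |T ∩ I|` for every interval `I`
(`exists_expansion`). The expansion is a rising sun construction: `S` is the set of busy times of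
a queue with arrivals at rate `1` during `T` and service at rate `s`, together with those of the
queue run backwards in time. The queue length is the difference between the surplus
`F x = ∫ (1_T - s)` and its running minimum, which is Lipschitz and has derivative `-s` almost
everywhere outside the busy set and `0` inside it; integrating gives a balance equation
(`rightExpansion_balance`) from which all bounds on `S` follow.

Put `r = 1 - α`, `τ_j = |T ∩ I(j)|` and `L_j = max τ_j (ℓ_j / r)`, which is at most `|I(j)|` since
`j` is tight. The load bounds for the expansions to the densities `s = r ^ k`, each multiplied by
`r ^ k`, say that the sum over `j ∈ G` of `max 0 (min (r ^ k L_j) τ_j - r ^ k ℓ_j)` is at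
most `2 m |T|`. Because `ℓ_j ≤ r L_j`, the sum over `k < n` of the `j`-th term telescopes to at least
`τ_j - r ^ n L_j` (`sub_pow_mul_le_sum_max`). As `β ℓ_j ≤ τ_j`, this is at least `τ_j / 2` once
`r ^ n ≤ β r / 2`, for which a number `n` of order `log_{1/r} (1/β̂)` suffices. Finally the `τ_j`
sum to at least `μ |T|`, hence `μ ≤ 4 n m` (`IsCriticalPair.le_machines_mul`). If `T` is a null
set, this says nothing, but then the jobs of `G` have laxity zero and `m ≥ μ` directly
(`IsCriticalPair.le_machines_of_null`).
-/

/-! ### Running minima -/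

/-- The running minimum of `F`: the infimum of `F` over the half-line up to `x`. -/
noncomputable def runningMin (F : ℝ → ℝ) (x : ℝ) : ℝ := sInf (F '' Set.Iic x)

section RunningMin

variable {F : ℝ → ℝ} (hF : ∀ x, BddBelow (F '' Set.Iic x))
include hF

theorem runningMin_le_of_le {u x : ℝ} (hux : u ≤ x) : runningMin F x ≤ F u :=
  csInf_le (hF x) ⟨u, hux, rfl⟩

theorem runningMin_antitone : Antitone (runningMin F) := fun x y hxy =>
  csInf_le_csInf (hF y) ⟨F x, x, Set.self_mem_Iic, rfl⟩ (Set.image_mono (Set.Iic_subset_Iic.2 hxy))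

/-- Between `x` and `y` the running minimum drops at most to the smallest value of `F` there. -/
theorem le_runningMin_of_forall_Icc {x y c : ℝ} (hcx : c ≤ runningMin F x)
    (hc : ∀ u ∈ Set.Icc x y, c ≤ F u) : c ≤ runningMin F y := by
  refine le_csInf ⟨F y, y, Set.self_mem_Iic, rfl⟩ ?_
  rintro _ ⟨u, hu, rfl⟩
  rcases le_total u x with h | h
  · exact hcx.trans (runningMin_le_of_le hF h)
  · exact hc u ⟨h, hu⟩

theorem lipschitzWith_runningMin {K : NNReal} (hK : LipschitzWith K F) :
    LipschitzWith K (runningMin F) := by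
  refine LipschitzWith.of_le_add_mul K fun x y => ?_
  rcases le_total y x with h | h
  · exact (runningMin_antitone hF h).trans (le_add_of_nonneg_right (by positivity))
  · have : runningMin F x - K * dist x y ≤ runningMin F y := by
      refine le_runningMin_of_forall_Icc hF (sub_le_self _ (by positivity)) fun u hu => ?_
      have h1 := hK.le_add_mul x u
      have h2 : dist x u ≤ dist x y := by
        rw [Real.dist_eq, Real.dist_eq, abs_sub_comm, abs_sub_comm x,
          abs_of_nonneg (sub_nonneg.2 hu.1), abs_of_nonneg (sub_nonneg.2 h)]
        linarith [hu.2]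
      have h3 := mul_le_mul_of_nonneg_left h2 K.coe_nonneg
      linarith [runningMin_le_of_le hF (le_refl x)]
    linarith

/-- Where `F` exceeds its running minimum, the running minimum is locally constant. -/
theorem hasDerivAt_runningMin_of_lt {x : ℝ} (hc : Continuous F) (hx : runningMin F x < F x) :
    HasDerivAt (runningMin F) 0 x := by
  obtain ⟨ε, hε, h⟩ := Metric.eventually_nhds_iff.1 (hc.continuousAt.eventually (lt_mem_nhds hx))
  refine (hasDerivAt_const x (runningMin F x)).congr_of_eventuallyEq ?_
  filter_upwards [Metric.ball_mem_nhds x hε] with y hy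
  have hy' : |y - x| < ε := hy
  rw [abs_lt] at hy'
  have hball : ∀ u, |u - x| ≤ |y - x| → runningMin F x < F u := fun u hu =>
    h (show |u - x| < ε from hu.trans_lt hy)
  rcases le_total x y with hxy | hxy
  · refine le_antisymm (runningMin_antitone hF hxy)
      (le_runningMin_of_forall_Icc hF le_rfl fun u hu => (hball u ?_).le)
    rw [abs_of_nonneg (sub_nonneg.2 hu.1), abs_of_nonneg (sub_nonneg.2 hxy)]
    linarith [hu.2]
  · refine le_antisymm ?_ (runningMin_antitone hF hxy)
    by_contra! hlt
    -- otherwise `F` would be bounded away from its infimum over `(-∞, x]` on both `(-∞, y]` and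
    -- the compact interval `[y, x]`
    have hcpt : ∃ u ∈ Set.Icc y x, ∀ v ∈ Set.Icc y x, F u ≤ F v :=
      isCompact_Icc.exists_isMinOn ⟨x, hxy, le_rfl⟩ hc.continuousOn
    obtain ⟨u, hu, hmin⟩ := hcpt
    have h1 : runningMin F x < F u := hball u (by
      rw [abs_of_nonpos (by linarith [hu.2]), abs_of_nonpos (by linarith)]
      linarith [hu.1])
    have h2 : min (runningMin F y) (F u) ≤ runningMin F x :=
      le_runningMin_of_forall_Icc hF (min_le_left _ _) fun v hv =>
        (min_le_right _ _).trans (hmin v hv)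
    exact absurd h2 (not_le.2 (lt_min hlt h1))

/-- At a time at which `F` attains its running minimum, the nonnegative function
`F - runningMin F` has a minimum, so that the two derivatives agree. -/
theorem deriv_runningMin_eq {x d : ℝ} (hx : runningMin F x = F x)
    (hm : DifferentiableAt ℝ (runningMin F) x) (hd : HasDerivAt F d x) :
    deriv (runningMin F) x = d := by
  have hmin : IsLocalMin (fun y => F y - runningMin F y) x :=
    Filter.Eventually.of_forall fun y => by
      simpa [hx] using runningMin_le_of_le hF (le_refl y)
  linarith [hmin.hasDerivAt_eq_zero (hd.sub hm.hasDerivAt)]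

end RunningMin

/-! ### The one-sided expansion of a set -/

/-- The surplus of `T` over density `s` up to time `x`; the base point `0` is immaterial. -/
noncomputable def surplus (T : Set ℝ) (s x : ℝ) : ℝ := ∫ t in (0 : ℝ)..x, (T.indicator 1 t - s)

/-- The expansion of `T` to the right: the times `x` such that `T` has density more than `s` on
some interval `[u, x]`. It is the set of busy times of a queue with arrival rate `1` on `T` and
service rate `s`. -/
def rightExpansion (T : Set ℝ) (s : ℝ) : Set ℝ :=
  {x | runningMin (surplus T s) x < surplus T s x}

section Expansion

variable {T : Set ℝ} {s : ℝ}

theorem surplus_integrand_locallyIntegrable (hT : MeasurableSet T) :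
    LocallyIntegrable (fun t => T.indicator (1 : ℝ → ℝ) t - s) volume :=
  ((locallyIntegrable_const (1 : ℝ)).indicator hT).sub (locallyIntegrable_const s)

theorem surplus_intervalIntegrable (hT : MeasurableSet T) (a b : ℝ) :
    IntervalIntegrable (fun t => T.indicator (1 : ℝ → ℝ) t - s) volume a b :=
  ((surplus_integrand_locallyIntegrable hT).integrableOn_isCompact
    isCompact_uIcc).intervalIntegrable

theorem surplus_sub (hT : MeasurableSet T) {a b : ℝ} (hab : a ≤ b) :
    surplus T s b - surplus T s a = volume.real (T ∩ Set.Icc a b) - s * (b - a) := by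
  rw [surplus, surplus, intervalIntegral.integral_interval_sub_left
    (surplus_intervalIntegrable hT _ _) (surplus_intervalIntegrable hT _ _),
    intervalIntegral.integral_sub _ (by simp), intervalIntegral.integral_of_le hab,
    ← integral_Icc_eq_integral_Ioc, integral_indicator_one hT,
    measureReal_restrict_apply hT]
  · simp [mul_comm]
  · exact (((locallyIntegrable_const (1 : ℝ)).indicator hT).integrableOn_isCompact
      isCompact_uIcc).intervalIntegrable

theorem lipschitzWith_surplus (hT : MeasurableSet T) (hs0 : 0 ≤ s) (hs1 : s ≤ 1) :
    LipschitzWith 1 (surplus T s) := by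
  refine LipschitzWith.of_le_add_mul 1 fun x y => ?_
  have key : ∀ a b : ℝ, a ≤ b → volume.real (T ∩ Set.Icc a b) ≤ b - a := fun a b hab => by
    refine (measureReal_mono Set.inter_subset_right (by simp)).trans ?_
    simp [hab]
  rw [Real.dist_eq, NNReal.coe_one, one_mul]
  rcases le_total x y with h | h
  · have h1 := surplus_sub (s := s) hT h
    have h2 : 0 ≤ volume.real (T ∩ Set.Icc x y) := measureReal_nonneg
    rw [abs_of_nonpos (by linarith)]
    nlinarith
  · have h1 := surplus_sub (s := s) hT h
    have h2 := key y x h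
    rw [abs_of_nonneg (by linarith)]
    nlinarith

theorem bddBelow_surplus (hT : MeasurableSet T) (hfin : volume T ≠ ⊤) (hs0 : 0 ≤ s) (x : ℝ) :
    BddBelow (surplus T s '' Set.Iic x) := by
  refine ⟨surplus T s x - volume.real T, ?_⟩
  rintro _ ⟨u, hu, rfl⟩
  have h1 := surplus_sub (s := s) hT (show u ≤ x from hu)
  have h2 : volume.real (T ∩ Set.Icc u x) ≤ volume.real T :=
    measureReal_mono Set.inter_subset_left hfin
  have h3 : 0 ≤ s * (x - u) := mul_nonneg hs0 (sub_nonneg.2 hu)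
  linarith

theorem measurableSet_rightExpansion (hT : MeasurableSet T) (hfin : volume T ≠ ⊤) (hs0 : 0 ≤ s)
    (hs1 : s ≤ 1) : MeasurableSet (rightExpansion T s) :=
  (isOpen_lt (lipschitzWith_runningMin (bddBelow_surplus hT hfin hs0)
    (lipschitzWith_surplus hT hs0 hs1)).continuous
    (lipschitzWith_surplus hT hs0 hs1).continuous).measurableSet

/-- For almost every `x` outside the expansion of `T`, the point `x` lies outside `T` and the
running minimum of the surplus decreases at rate `s`. -/
theorem ae_deriv_runningMin_surplus (hT : MeasurableSet T) (hfin : volume T ≠ ⊤) (hs0 : 0 ≤ s)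
    (hs1 : s < 1) : ∀ᵐ x, deriv (runningMin (surplus T s)) x =
      (rightExpansion T s)ᶜ.indicator (fun _ => -s) x := by
  have hF := bddBelow_surplus hT hfin hs0
  have hL := lipschitzWith_surplus hT hs0 hs1.le
  filter_upwards [(lipschitzWith_runningMin hF hL).ae_differentiableAt,
    LocallyIntegrable.ae_hasDerivAt_integral
      (surplus_integrand_locallyIntegrable (s := s) hT)] with x hm hd
  by_cases hx : x ∈ rightExpansion T s
  · rw [Set.indicator_of_notMem (by simpa using hx)]
    exact (hasDerivAt_runningMin_of_lt hF hL.continuous hx).deriv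
  · rw [Set.indicator_of_mem hx]
    have heq : runningMin (surplus T s) x = surplus T s x :=
      le_antisymm (runningMin_le_of_le hF le_rfl) (not_lt.1 hx)
    have h1 := deriv_runningMin_eq hF heq hm (hd 0)
    have h2 : deriv (runningMin (surplus T s)) x ≤ 0 := (runningMin_antitone hF).deriv_nonpos
    by_cases hxT : x ∈ T
    · rw [h1, Set.indicator_of_mem hxT, Pi.one_apply] at h2
      linarith
    · rw [h1, Set.indicator_of_notMem hxT, zero_sub]

/-- The balance equation of the queue: the change of its length `surplus - runningMin` over
`[a, b]` is what arrives minus what is served. -/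
theorem rightExpansion_balance (hT : MeasurableSet T) (hfin : volume T ≠ ⊤) (hs0 : 0 ≤ s)
    (hs1 : s < 1) {a b : ℝ} (hab : a ≤ b) :
    (surplus T s b - runningMin (surplus T s) b) - (surplus T s a - runningMin (surplus T s) a) =
      volume.real (T ∩ Set.Icc a b) - s * volume.real (rightExpansion T s ∩ Set.Icc a b) := by
  have hF := bddBelow_surplus hT hfin hs0
  have hE := measurableSet_rightExpansion hT hfin hs0 hs1.le
  have h1 := ((lipschitzWith_runningMin hF (lipschitzWith_surplus hT hs0 hs1.le)).lipschitzOnWith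
    (s := Set.uIcc a b)).absolutelyContinuousOnInterval.integral_deriv_eq_sub
  rw [intervalIntegral.integral_congr_ae
    ((ae_deriv_runningMin_surplus hT hfin hs0 hs1).mono fun x hx _ => hx),
    intervalIntegral.integral_of_le hab, ← integral_Icc_eq_integral_Ioc,
    integral_indicator_const _ hE.compl, measureReal_restrict_apply hE.compl] at h1
  have h2 : volume.real (Set.Icc a b ∩ rightExpansion T s) +
      volume.real (Set.Icc a b \ rightExpansion T s) = volume.real (Set.Icc a b) :=
    measureReal_inter_add_sdiff hE (by simp)
  rw [Set.inter_comm, Set.sdiff_eq, Set.inter_comm (Set.Icc a b)] at h2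
  simp only [Real.volume_real_Icc_of_le hab, smul_eq_mul] at h1 h2
  have h3 := surplus_sub (s := s) hT hab
  linear_combination h3 + h1 + s * h2

/-- The expansion is no larger than the queue can account for. -/
theorem measure_rightExpansion_le (hT : MeasurableSet T) {a b : ℝ} (hTab : T ⊆ Set.Icc a b)
    (hab : a ≤ b) (hs0 : 0 ≤ s) (hs1 : s < 1) :
    s * volume.real (rightExpansion T s ∩ Set.Icc a b) ≤ volume.real T := by
  have hfin : volume T ≠ ⊤ := measure_ne_top_of_subset hTab (by simp)
  have hF := bddBelow_surplus hT hfin hs0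
  have h := rightExpansion_balance hT hfin hs0 hs1 hab
  rw [Set.inter_eq_left.2 hTab] at h
  have h1 := runningMin_le_of_le hF (le_refl b)
  -- the queue is empty at `a`, since nothing has arrived before
  have h2 : surplus T s a ≤ runningMin (surplus T s) a := by
    refine le_csInf ⟨_, a, Set.self_mem_Iic, rfl⟩ ?_
    rintro _ ⟨u, hu, rfl⟩
    have h3 := surplus_sub (s := s) hT (show u ≤ a from hu)
    have h4 : volume.real (T ∩ Set.Icc u a) = 0 := by
      have hsub : T ∩ Set.Icc u a ⊆ {a} := fun x hx => le_antisymm hx.2.2 (hTab hx.1).1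
      rw [measureReal_def, measure_mono_null hsub Real.volume_singleton, ENNReal.toReal_zero]
    have h5 : 0 ≤ s * (a - u) := mul_nonneg hs0 (sub_nonneg.2 hu)
    linarith
  linarith

/-- If the queue is empty at `b`, then everything that arrives from `a` on has been served. -/
theorem le_measure_rightExpansion (hT : MeasurableSet T) (hfin : volume T ≠ ⊤) (hs0 : 0 ≤ s)
    (hs1 : s < 1) {a b : ℝ} (hab : a ≤ b) (hb : b ∉ rightExpansion T s) :
    volume.real (T ∩ Set.Icc a b) ≤ s * volume.real (rightExpansion T s ∩ Set.Icc a b) := by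
  have h := rightExpansion_balance hT hfin hs0 hs1 hab
  have h1 := runningMin_le_of_le (bddBelow_surplus hT hfin hs0) (le_refl a)
  have h2 : surplus T s b ≤ runningMin (surplus T s) b := not_lt.1 hb
  linarith

end Expansion

/-! ### The two-sided expansion -/

theorem volume_real_neg_preimage (S : Set ℝ) : volume.real (Neg.neg ⁻¹' S) = volume.real S := by
  simp [Measure.real]

/-- A set `T` can be expanded to a set `S` of measure at most `2 / s` times that of `T` which
fills every interval on which `T` has density at least `s`, and which occupies at least
`1 / s` times as much as `T` does of any other interval. -/
theorem exists_expansion {T : Set ℝ} (hT : MeasurableSet T) {A B s : ℝ} (hTAB : T ⊆ Set.Icc A B)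
    (hAB : A ≤ B) (hs0 : 0 < s) (hs1 : s ≤ 1) :
    ∃ S : Set ℝ, MeasurableSet S ∧ S ⊆ Set.Icc A B ∧ s * volume.real S ≤ 2 * volume.real T ∧
      ∀ a b, A ≤ a → a ≤ b → b ≤ B →
        min (s * (b - a)) (volume.real (T ∩ Set.Icc a b)) ≤ s * volume.real (S ∩ Set.Icc a b) := by
  rcases hs1.eq_or_lt with rfl | hs1
  -- at density `1` the queue is always empty, but `T` itself will do
  · refine ⟨T, hT, hTAB, ?_, fun a b _ _ _ => ?_⟩
    · linarith [measureReal_nonneg (μ := volume) (s := T)]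
    · rw [one_mul, one_mul]
      exact min_le_right _ _
  have hfin : volume T ≠ ⊤ := measure_ne_top_of_subset hTAB (by simp)
  have hT' : MeasurableSet (Neg.neg ⁻¹' T) := measurable_neg hT
  have hfin' : volume (Neg.neg ⁻¹' T) ≠ ⊤ := by simpa using hfin
  set R := rightExpansion T s with hR
  set L := Neg.neg ⁻¹' rightExpansion (Neg.neg ⁻¹' T) s with hL
  have hRm : MeasurableSet R := measurableSet_rightExpansion hT hfin hs0.le hs1.le
  have hLm : MeasurableSet L :=
    measurable_neg (measurableSet_rightExpansion hT' hfin' hs0.le hs1.le)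
  have hneg : ∀ (X : Set ℝ) (a b : ℝ), volume.real (Neg.neg ⁻¹' X ∩ Set.Icc a b) =
      volume.real (X ∩ Set.Icc (-b) (-a)) := fun X a b => by
    rw [← volume_real_neg_preimage (X ∩ _), Set.preimage_inter, Set.neg_preimage, Set.neg_preimage,
      Set.neg_Icc, neg_neg, neg_neg]
  have hRle : s * volume.real (R ∩ Set.Icc A B) ≤ volume.real T :=
    measure_rightExpansion_le hT hTAB hAB hs0.le hs1
  have hLle : s * volume.real (L ∩ Set.Icc A B) ≤ volume.real T := by
    have h := measure_rightExpansion_le hT' (a := -B) (b := -A) (s := s)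
      (fun x hx => by have := hTAB hx; exact ⟨by linarith [this.2], by linarith [this.1]⟩)
      (neg_le_neg hAB) hs0.le hs1
    rwa [volume_real_neg_preimage, ← hneg] at h
  refine ⟨(R ∪ L) ∩ Set.Icc A B, (hRm.union hLm).inter measurableSet_Icc,
    Set.inter_subset_right, ?_, fun a b hAa hab hbB => ?_⟩
  · rw [Set.union_inter_distrib_right]
    have := mul_le_mul_of_nonneg_left
      (measureReal_union_le (μ := volume) (R ∩ Set.Icc A B) (L ∩ Set.Icc A B)) hs0.le
    linarith
  rw [Set.inter_assoc, Set.inter_eq_right.2 (Set.Icc_subset_Icc hAa hbB)]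
  by_cases hsub : Set.Icc a b ⊆ R ∪ L
  · rw [Set.inter_eq_right.2 hsub, Real.volume_real_Icc_of_le hab]
    exact min_le_left _ _
  obtain ⟨x, hx, hxS⟩ := Set.not_subset.1 hsub
  refine (min_le_right _ _).trans ?_
  have hxR : x ∉ R := fun h => hxS (Or.inl h)
  have hxL : -x ∉ rightExpansion (Neg.neg ⁻¹' T) s := fun h => hxS (Or.inr h)
  have h1 := le_measure_rightExpansion hT hfin hs0.le hs1 hx.1 hxR
  have h2 := le_measure_rightExpansion hT' hfin' hs0.le hs1 (neg_le_neg hx.2) hxL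
  rw [hneg, neg_neg, neg_neg] at h2
  have h3 : volume.real (rightExpansion (Neg.neg ⁻¹' T) s ∩ Set.Icc (-b) (-x)) =
      volume.real (L ∩ Set.Icc x b) := (hneg _ x b).symm
  rw [h3] at h2
  have hsplit : T ∩ Set.Icc a b = (T ∩ Set.Icc a x) ∪ (T ∩ Set.Icc x b) := by
    rw [← Set.inter_union_distrib_left, Set.Icc_union_Icc_eq_Icc hx.1 hx.2]
  have h4 : volume.real (T ∩ Set.Icc a b) ≤
      volume.real (T ∩ Set.Icc a x) + volume.real (T ∩ Set.Icc x b) := by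
    rw [hsplit]
    exact measureReal_union_le _ _
  have hnt : ∀ (X : Set ℝ) (u v : ℝ), volume (X ∩ Set.Icc u v) ≠ ⊤ := fun X u v =>
    measure_ne_top_of_subset Set.inter_subset_right (by simp)
  have h5 : volume.real (R ∩ Set.Icc a x) + volume.real (L ∩ Set.Icc x b) ≤
      volume.real ((R ∪ L) ∩ Set.Icc a b) := by
    rw [← measureReal_union₀ (hLm.inter measurableSet_Icc).nullMeasurableSet _ (hnt _ _ _)
      (hnt _ _ _)]
    · refine measureReal_mono ?_ (hnt _ _ _)
      rintro y (hy | hy)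
      · exact ⟨Or.inl hy.1, hy.2.1, hy.2.2.trans hx.2⟩
      · exact ⟨Or.inr hy.1, hx.1.trans hy.2.1, hy.2.2⟩
    · refine measure_mono_null (t := {x}) (fun y hy => ?_) (by simp)
      exact le_antisymm hy.1.2.2 hy.2.2.1
  have h6 := mul_le_mul_of_nonneg_left h5 hs0.le
  linarith

/-! ### The load bound -/

theorem volume_inter_lifespan_ne_top (X : Set ℝ) (j : Job) : volume (X ∩ j.lifespan) ≠ ⊤ :=
  measure_ne_top_of_subset Set.inter_subset_right (by simp [Job.lifespan])

theorem volume_inter_lifespan (X : Set ℝ) (j : Job) :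
    volume.real (X ∩ j.lifespan) = volume.real (X ∩ Set.Icc j.release j.deadline) :=
  measureReal_congr ((Filter.EventuallyEq.refl _ X).inter Ico_ae_eq_Icc)

/-- Of the measure of `S ∩ I(j)`, all but `ℓ_j` has to be used for processing `j`, and `m` machines
offer `m |S|` units of processing during `S`. -/
theorem Schedulable.sum_load_le {ι : Type*} [Fintype ι] {J : ι → Job} {m : ℕ}
    (h : Schedulable J m) {S : Set ℝ} (hS : MeasurableSet S) (hfin : volume S ≠ ⊤) :
    ∑ j, max 0 (volume.real (S ∩ (J j).lifespan) - (J j).laxity) ≤ m * volume.real S := by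
  obtain ⟨σ, hσ⟩ := h
  have hsub : ∀ i j, {t | σ i t = some j} ⊆ (J j).lifespan := fun i j t ht =>
    hσ.mem_lifespan i t j ht
  have hlen : ∀ j, volume.real (J j).lifespan = (J j).deadline - (J j).release := fun j => by
    have h1 := (J j).size_pos
    have h2 := (J j).size_le
    simp only [Job.lifespan, Real.volume_real_Ico]
    exact max_eq_left (by linarith)
  have hnt : ∀ j, volume (J j).lifespan ≠ ⊤ := fun j => by simp [Job.lifespan]
  have hjob : ∀ j, max 0 (volume.real (S ∩ (J j).lifespan) - (J j).laxity) ≤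
      ∑ i, volume.real (S ∩ {t | σ i t = some j}) := by
    intro j
    refine max_le (Finset.sum_nonneg fun i _ => measureReal_nonneg) ?_
    set P : Set ℝ := ⋃ i, {t | σ i t = some j} with hP
    have hPm : MeasurableSet P := MeasurableSet.iUnion fun i => hσ.measurableSet i j
    have hPsub : P ⊆ (J j).lifespan := Set.iUnion_subset fun i => hsub i j
    have hPsize : volume.real P = (J j).size := by
      rw [hP, measureReal_iUnion_fintype _ (fun i => hσ.measurableSet i j)
        (fun i => measure_ne_top_of_subset (hsub i j) (hnt j)), hσ.complete]
      exact fun i i' hii => Set.disjoint_left.2 fun t ht ht' =>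
        hii (hσ.not_parallel i i' t j ht ht')
    have h1 : volume.real (S ∩ P) ≤ ∑ i, volume.real (S ∩ {t | σ i t = some j}) := by
      rw [hP, Set.inter_iUnion]
      exact measureReal_iUnion_fintype_le _
    have h2 : volume.real (S ∩ (J j).lifespan) ≤
        volume.real (S ∩ P) + volume.real ((J j).lifespan \ P) := by
      refine (measureReal_mono (fun t ht => ?_) (measure_union_ne_top
        (measure_ne_top_of_subset Set.inter_subset_left hfin)
        (measure_ne_top_of_subset Set.sdiff_subset (hnt j)))).trans (measureReal_union_le _ _)
      by_cases htP : t ∈ P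
      · exact Or.inl ⟨ht.1, htP⟩
      · exact Or.inr ⟨ht.2, htP⟩
    rw [measureReal_sdiff hPsub hPm (hnt j), hPsize, hlen] at h2
    rw [Job.laxity]
    linarith
  have hmachine : ∀ i, ∑ j, volume.real (S ∩ {t | σ i t = some j}) ≤ volume.real S := by
    intro i
    rw [← measureReal_iUnion_fintype _ (fun j => hS.inter (hσ.measurableSet i j))
      (fun j => measure_ne_top_of_subset Set.inter_subset_left hfin)]
    · exact measureReal_mono (Set.iUnion_subset fun j => Set.inter_subset_left) hfin
    · exact fun j j' hjj => Set.disjoint_left.2 fun t ht ht' =>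
        hjj (Option.some.inj (ht.2.symm.trans ht'.2))
  calc _ ≤ ∑ j, ∑ i, volume.real (S ∩ {t | σ i t = some j}) :=
        Finset.sum_le_sum fun j _ => hjob j
    _ = ∑ i, ∑ j, volume.real (S ∩ {t | σ i t = some j}) := Finset.sum_comm
    _ ≤ ∑ _i : Fin m, volume.real S := Finset.sum_le_sum fun i _ => hmachine i
    _ = m * volume.real S := by simp

/-- Double counting: sets which cover each point of `T` at least `μ` times meet `T` in total
measure at least `μ |T|`. -/
theorem mul_measure_le_sum_of_covered {ι : Type*} [Fintype ι] {J : ι → Job} {G : Set ι}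
    [DecidablePred (· ∈ G)] {T : Set ℝ} {μ : ℕ} (hT : MeasurableSet T) (hfin : volume T ≠ ⊤)
    (hcov : ∀ t ∈ T, μ ≤ {j | j ∈ G ∧ t ∈ (J j).lifespan}.ncard) :
    μ * volume.real T ≤ ∑ j with j ∈ G, volume.real (T ∩ (J j).lifespan) := by
  classical
  have hm : ∀ j, MeasurableSet (J j).lifespan := fun j => measurableSet_Ico
  have : IsFiniteMeasure (volume.restrict T) := ⟨by simpa using hfin.lt_top⟩
  have hint : ∀ j, Integrable ((J j).lifespan.indicator (1 : ℝ → ℝ)) (volume.restrict T) :=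
    fun j => (integrable_const (1 : ℝ)).indicator (hm j)
  have h1 : ∫ _ in T, (μ : ℝ) ≤
      ∫ t in T, ∑ j with j ∈ G, (J j).lifespan.indicator (1 : ℝ → ℝ) t := by
    refine setIntegral_mono_on (integrable_const _) (integrable_finsetSum _ fun j _ => hint j) hT
      fun t ht => ?_
    have h2 : {j | j ∈ G ∧ t ∈ (J j).lifespan}.ncard =
        ((Finset.univ.filter (· ∈ G)).filter (fun j => t ∈ (J j).lifespan)).card := by
      rw [← Set.ncard_coe_finset]
      congr 1
      ext j
      simp
    have h3 := hcov t ht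
    rw [h2] at h3
    simp only [Set.indicator_apply, Pi.one_apply]
    rw [Finset.sum_boole]
    exact_mod_cast h3
  rw [integral_finsetSum _ fun j _ => hint j, setIntegral_const, smul_eq_mul, mul_comm] at h1
  refine h1.trans (le_of_eq (Finset.sum_congr rfl fun j _ => ?_))
  rw [integral_indicator_one (hm j), measureReal_restrict_apply (hm j), Set.inter_comm]

/-- The telescoping estimate behind the choice of levels `r ^ k`: with `y k = min (r ^ k * L) τ`,
the `k`-th summand is at least `y k - y (k + 1)`. -/
theorem sub_pow_mul_le_sum_max {r τ ℓ L : ℝ} (hr0 : 0 ≤ r) (hℓ : ℓ ≤ r * L)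
    (hτ : τ ≤ L) (n : ℕ) :
    τ - r ^ n * L ≤ ∑ k ∈ Finset.range n, max 0 (min (r ^ k * L) τ - r ^ k * ℓ) := by
  have hstep : ∀ k, min (r ^ k * L) τ - min (r ^ (k + 1) * L) τ ≤
      max 0 (min (r ^ k * L) τ - r ^ k * ℓ) := by
    intro k
    have hk : 0 ≤ r ^ k := pow_nonneg hr0 k
    rcases le_total (r ^ (k + 1) * L) τ with h | h
    · refine le_trans ?_ (le_max_right _ _)
      rw [min_eq_left h, pow_succ, mul_assoc]
      linarith [mul_le_mul_of_nonneg_left hℓ hk]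
    · refine le_trans ?_ (le_max_left _ _)
      rw [min_eq_right h]
      linarith [min_le_right (r ^ k * L) τ]
  have hsum := Finset.sum_le_sum fun k (_ : k ∈ Finset.range n) => hstep k
  rw [Finset.sum_range_sub' (fun k => min (r ^ k * L) τ)] at hsum
  rw [pow_zero, one_mul, min_eq_right hτ] at hsum
  linarith [min_le_left (r ^ n * L) τ]

/-! ### Critical pairs -/

section Critical

variable {ι : Type*} [Fintype ι] {J : ι → Job} {α β : ℝ} {μ : ℕ} {G : Set ι} {T : Set ℝ}

theorem IsFiniteUnionOfIntervals.measurableSet (hT : IsFiniteUnionOfIntervals T) :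
    MeasurableSet T := by
  obtain ⟨F, hF, hI, rfl⟩ := hT
  exact MeasurableSet.sUnion hF.countable fun I h => (hI I h).measurableSet

theorem Job.IsTight.laxity_le {j : Job} (h : j.IsTight α) :
    j.laxity ≤ (1 - α) * (j.deadline - j.release) := by
  rw [Job.IsTight] at h
  rw [Job.laxity]
  linarith

theorem Job.laxity_nonneg (j : Job) : 0 ≤ j.laxity := by
  rw [Job.laxity]
  linarith [j.size_le]

/-- If `T` is a null set, then the jobs of `G` have no laxity, and those alive at a time `t ∈ T` are
all processed immediately after `t`. -/
theorem IsCriticalPair.le_machines_of_null {m : ℕ} (hm : Schedulable J m)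
    (hc : IsCriticalPair J α μ β G T) (hβ : 0 < β) (hT : volume T = 0) : μ ≤ m := by
  classical
  obtain ⟨t, ht⟩ := hc.nonempty
  set H : Finset ι := Finset.univ.filter fun j => j ∈ G ∧ t ∈ (J j).lifespan with hH
  have hcard : μ ≤ H.card := by
    have h := hc.covered t ht
    rwa [← Set.ncard_coe_finset, hH, Finset.coe_filter_univ]
  have hε : ∃ ε > 0, ∀ j ∈ H, t + ε ≤ (J j).deadline := by
    have h1 : ∀ᶠ u in nhdsWithin t (Set.Ioi t), ∀ j ∈ H, u ≤ (J j).deadline := by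
      rw [Filter.eventually_all_finset]
      intro j hj
      have h2 : t < (J j).deadline := (Finset.mem_filter.1 hj).2.2.2
      exact (eventually_nhdsWithin_of_eventually_nhds (gt_mem_nhds h2)).mono fun u hu => hu.le
    obtain ⟨u, hu, hut⟩ := (h1.and self_mem_nhdsWithin).exists
    exact ⟨u - t, sub_pos.2 hut, fun j hj => by simpa using hu j hj⟩
  obtain ⟨ε, hε0, hε⟩ := hε
  have hload := hm.sum_load_le (S := Set.Ico t (t + ε)) measurableSet_Ico (by simp)
  have hvol : volume.real (Set.Ico t (t + ε)) = ε := by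
    rw [Real.volume_real_Ico_of_le (by linarith)]
    ring
  have hj : ∀ j ∈ H, ε ≤
      max 0 (volume.real (Set.Ico t (t + ε) ∩ (J j).lifespan) - (J j).laxity) := by
    intro j hj
    obtain ⟨hjG, hjt⟩ := (Finset.mem_filter.1 hj).2
    have h1 : (J j).laxity ≤ 0 := by
      have h2 := hc.laxity_le j hjG
      rw [measureReal_def, measure_mono_null Set.inter_subset_left hT, ENNReal.toReal_zero] at h2
      exact nonpos_of_mul_nonpos_right h2 hβ
    rw [Job.lifespan, Set.inter_eq_left.2 (Set.Ico_subset_Ico hjt.1 (hε j hj)), hvol]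
    exact le_max_of_le_right (by linarith)
  have h1 : H.card * ε ≤ m * ε := by
    rw [hvol] at hload
    refine le_trans ?_ hload
    rw [← nsmul_eq_mul]
    exact (Finset.card_nsmul_le_sum H _ ε hj).trans (Finset.sum_le_sum_of_subset_of_nonneg
      (Finset.subset_univ H) fun j _ _ => le_max_left _ _)
  have h2 : (H.card : ℝ) ≤ m := le_of_mul_le_mul_right h1 hε0
  exact hcard.trans (by exact_mod_cast h2)

/-- Adding up the load bounds of the expansions of `T` to the densities `r ^ k`, for `k < n`. -/
theorem IsCriticalPair.le_machines_mul {m : ℕ} (hm : Schedulable J m)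
    (hc : IsCriticalPair J α μ β G T) (hα0 : 0 < α) (hα1 : α < 1) (hβ0 : 0 < β) (hβ1 : β < 1)
    {n : ℕ} (hn : (1 - α) ^ n ≤ β * (1 - α) / 2) : (μ : ℝ) ≤ 4 * n * m := by
  classical
  set r : ℝ := 1 - α with hr
  have hr0 : 0 < r := by linarith
  have hr1 : r < 1 := by linarith
  have hn1 : (1 : ℝ) ≤ n := by
    rcases Nat.eq_zero_or_pos n with rfl | h
    · rw [pow_zero] at hn
      nlinarith
    · exact_mod_cast h
  rcases Nat.eq_zero_or_pos μ with rfl | hμ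
  · rw [Nat.cast_zero]
    positivity
  by_cases hT0 : volume T = 0
  · have h : (μ : ℝ) ≤ m := by exact_mod_cast hc.le_machines_of_null hm hβ0 hT0
    nlinarith [Nat.cast_nonneg (α := ℝ) m]
  have hTm := hc.intervals.measurableSet
  have hlife : ∀ j, (J j).release ≤ (J j).deadline := fun j => by
    linarith [(J j).size_pos, (J j).size_le]
  obtain ⟨A, hA⟩ := (Set.finite_range fun j => (J j).release).bddBelow
  obtain ⟨B, hB⟩ := (Set.finite_range fun j => (J j).deadline).bddAbove
  replace hA : ∀ j, A ≤ (J j).release := fun j => hA ⟨j, rfl⟩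
  replace hB : ∀ j, (J j).deadline ≤ B := fun j => hB ⟨j, rfl⟩
  have hTAB : T ⊆ Set.Icc A B := by
    intro t ht
    obtain ⟨j, -, hj⟩ := Set.nonempty_of_ncard_ne_zero
      (hμ.trans_le (hc.covered t ht)).ne'
    exact ⟨(hA j).trans hj.1, hj.2.le.trans (hB j)⟩
  have hAB : A ≤ B := by
    obtain ⟨t, ht⟩ := hc.nonempty
    exact (hTAB ht).1.trans (hTAB ht).2
  have hfin : volume T ≠ ⊤ := measure_ne_top_of_subset hTAB (by simp)
  have hTpos : 0 < volume.real T := ENNReal.toReal_pos hT0 hfin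
  set τ : ι → ℝ := fun j => volume.real (T ∩ (J j).lifespan)
  -- A job of small laxity may have a very long lifespan, of which only the length `L j` is used:
  -- it is enough for the job to be tight with respect to it, and it is at most `τ j / (β * r)`, so
  -- that `n` levels suffice for `r ^ n * L j` to be small compared to `τ j`.
  set L : ι → ℝ := fun j => max (τ j) ((J j).laxity / r) with hL
  have hτ0 : ∀ j, 0 ≤ τ j := fun j => measureReal_nonneg
  have hτL : ∀ j, τ j ≤ L j := fun j => le_max_left _ _
  have hlaxL : ∀ j, (J j).laxity ≤ r * L j := fun j => by
    have := mul_le_mul_of_nonneg_left (le_max_right (τ j) ((J j).laxity / r)) hr0.le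
    rwa [mul_div_cancel₀ _ hr0.ne'] at this
  have hLlen : ∀ j ∈ G, L j ≤ (J j).deadline - (J j).release := by
    intro j hj
    refine max_le ?_ ((div_le_iff₀' hr0).2 (hc.tight j hj).laxity_le)
    refine (measureReal_mono Set.inter_subset_right (by simp [Job.lifespan])).trans ?_
    rw [Job.lifespan, Real.volume_real_Ico_of_le (hlife j)]
  have hrn : r ^ n ≤ 1 / 2 := by nlinarith
  have hsmall : ∀ j ∈ G, r ^ n * L j ≤ τ j / 2 := by
    intro j hj
    have hpow : 0 ≤ r ^ n := pow_nonneg hr0.le n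
    rw [hL, mul_max_of_nonneg _ _ hpow]
    refine max_le ?_ ?_
    · nlinarith [hτ0 j]
    · have h1 : (J j).laxity / r ≥ 0 := div_nonneg (Job.laxity_nonneg _) hr0.le
      have h2 := mul_le_mul_of_nonneg_right hn h1
      have h3 : β * r / 2 * ((J j).laxity / r) = β * (J j).laxity / 2 := by
        field_simp
      have h4 : β * (J j).laxity ≤ τ j := hc.laxity_le j hj
      linarith
  have hlevel : ∀ k, ∑ j with j ∈ G, max 0 (min (r ^ k * L j) (τ j) - r ^ k * (J j).laxity) ≤
      2 * volume.real T * m := by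
    intro k
    have hk : 0 < r ^ k := pow_pos hr0 k
    obtain ⟨S, hSm, hSAB, hSle, hSge⟩ :=
      exists_expansion hTm hTAB hAB hk (pow_le_one₀ hr0.le hr1.le)
    have hload := mul_le_mul_of_nonneg_left
      (hm.sum_load_le hSm (measure_ne_top_of_subset hSAB (by simp))) hk.le
    rw [Finset.mul_sum] at hload
    calc _ ≤ ∑ j with j ∈ G,
          r ^ k * max 0 (volume.real (S ∩ (J j).lifespan) - (J j).laxity) := by
          refine Finset.sum_le_sum fun j hj => ?_
          have hjG := (Finset.mem_filter.1 hj).2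
          rw [mul_max_of_nonneg 0 _ hk.le, mul_zero, mul_sub]
          refine max_le_max le_rfl (sub_le_sub_right ?_ _)
          have h1 := hSge _ _ (hA j) (hlife j) (hB j)
          rw [← volume_inter_lifespan, ← volume_inter_lifespan] at h1
          exact (min_le_min_right _ (mul_le_mul_of_nonneg_left (hLlen j hjG) hk.le)).trans h1
      _ ≤ ∑ j, r ^ k * max 0 (volume.real (S ∩ (J j).lifespan) - (J j).laxity) :=
          Finset.sum_le_sum_of_subset_of_nonneg (Finset.filter_subset _ _) fun j _ _ =>
            mul_nonneg hk.le (le_max_left _ _)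
      _ ≤ r ^ k * (m * volume.real S) := hload
      _ = r ^ k * volume.real S * m := by ring
      _ ≤ 2 * volume.real T * m := mul_le_mul_of_nonneg_right hSle m.cast_nonneg
  have hsum := Finset.sum_le_sum fun k (_ : k ∈ Finset.range n) => hlevel k
  rw [Finset.sum_comm, Finset.sum_const, Finset.card_range, nsmul_eq_mul] at hsum
  have hhalf : ∑ j with j ∈ G, τ j / 2 ≤ n * (2 * volume.real T * m) := by
    refine le_trans (Finset.sum_le_sum fun j hj => ?_) hsum
    have h1 := sub_pow_mul_le_sum_max hr0.le (hlaxL j) (hτL j) n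
    have h2 := hsmall j (Finset.mem_filter.1 hj).2
    linarith
  rw [← Finset.sum_div] at hhalf
  have hcov := mul_measure_le_sum_of_covered hTm hfin hc.covered
  refine le_of_mul_le_mul_right ?_ hTpos
  linarith

end Critical

theorem mainTheorem3 :
    ∃ c : ℝ, 0 < c ∧
      ∀ (ι : Type) [Fintype ι] (J : ι → Job) (α β : ℝ) (μ : ℕ) (G : Set ι) (T : Set ℝ),
        0 < α → α < 1 → 0 < β → β < 1 →
        (∀ j, (J j).IsTight α) →
        IsCriticalPair J α μ β G T →
        c * ((μ : ℝ) / Real.logb (1 / (1 - α)) (1 / min β (min (1 / 2) (1 - α)))) ≤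
          (minMachines J : ℝ) := by
  refine ⟨1 / 16, by norm_num, fun ι _ J α β μ G T hα0 hα1 hβ0 hβ1 _ hc => ?_⟩
  set r : ℝ := 1 - α with hr
  have hr0 : 0 < r := by linarith
  have hr1 : r < 1 := by linarith
  set b : ℝ := min β (min (1 / 2) r) with hb
  have hb0 : 0 < b := lt_min hβ0 (lt_min (by norm_num) hr0)
  have hbβ : b ≤ β := min_le_left _ _
  have hb2 : b ≤ 1 / 2 := (min_le_right _ _).trans (min_le_left _ _)
  have hbr : b ≤ r := (min_le_right _ _).trans (min_le_right _ _)
  have hr' : 1 < 1 / r := (one_lt_div hr0).2 hr1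
  set Q : ℝ := Real.logb (1 / r) (1 / b) with hQ
  have hQ1 : 1 ≤ Q := by
    rw [hQ, Real.le_logb_iff_rpow_le hr' (by positivity), Real.rpow_one]
    exact one_div_le_one_div_of_le hb0 hbr
  have hrQ : r ^ Q = b := by
    have h := Real.rpow_logb (by positivity) hr'.ne' (show 0 < 1 / b by positivity)
    rw [← hQ, one_div, one_div, Real.inv_rpow hr0.le] at h
    exact inv_injective h
  -- `n = ⌈3 Q⌉` levels bring the density down to `b ^ 3 ≤ β * (1 / 2) * (1 - α)`
  have hn : r ^ ⌈3 * Q⌉₊ ≤ β * r / 2 := by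
    calc r ^ ⌈3 * Q⌉₊ = r ^ ((⌈3 * Q⌉₊ : ℕ) : ℝ) := (Real.rpow_natCast _ _).symm
      _ ≤ r ^ (3 * Q) := Real.rpow_le_rpow_of_exponent_ge hr0 hr1.le (Nat.le_ceil _)
      _ = b * (b * b) := by
          rw [mul_comm, Real.rpow_mul hr0.le, hrQ, show (3 : ℝ) = (3 : ℕ) by norm_num,
            Real.rpow_natCast]
          ring
      _ ≤ β * (1 / 2 * r) := by gcongr
      _ = β * r / 2 := by ring
  have hnQ : (⌈3 * Q⌉₊ : ℝ) ≤ 4 * Q := by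
    linarith [Nat.ceil_lt_add_one (show 0 ≤ 3 * Q by linarith)]
  have h := hc.le_machines_mul (schedulable_minMachines J) hα0 hα1 hβ0 hβ1 hn
  have h1 : (⌈3 * Q⌉₊ : ℝ) * minMachines J ≤ 4 * Q * minMachines J :=
    mul_le_mul_of_nonneg_right hnQ (Nat.cast_nonneg _)
  rw [div_mul_div_comm, one_mul, div_le_iff₀ (by linarith)]
  linarith
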